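/- Let $\langle \mathbb V(X),\mathbb V(X),*\rangle$ be a single superstructure model of nonstandard methods: $X$ is an infinite set of atoms, $\mathbb V(X)=\bigcup_n V_n(X)$ with $V_0(X)=X$, $V_{n+1}(X)=V_n(X)\cup\mathcal P(V_n(X))$ is the superstructure over $X$, and $*:\mathbb V(X)\to\mathbb V(X)$ satisfies the transfer principle for bounded formulas of the language $\{\in,=\}$. For $a\in{}^*Y$ let $\mathfrak U_a=\{A\subseteq Y : a\in{}^*A\}$ be the ultrafilter on $Y$ generated by $a$; for $a\in{}^{**}Y$ the ultrafilter on $Y$ generated by $a$ is $\{A\subseteq Y: a\in{}^{**}A\}$. For ultrafilters $\mathcal U_1,\mathcal U_2$ on $S_1,S_2$, a set $A\subseteq S_1\times S_2$ belongs to $\mathcal U_1\otimes\mathcal U_2$ iff $\{s_1\in S_1:\{s_2\in S_2:(s_1,s_2)\in A\}\in\mathcal U_2\}\in\mathcal U_1$. A pair $(\alpha,\beta)\in{}^*(S_1\times S_2)$ is a tensor pair (for $S_1,S_2$) if $\mathfrak U_{(\alpha,\beta)}=\mathfrak U_\alpha\otimes\mathfrak U_\beta$. A set $Y$ is completely coherent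 if $A\subseteq{}^*A$ for every $A\subseteq Y$ (equivalently ${}^*y=y$ for all $y\in Y$). Theorem. Let $S_1,S_2\in\mathbb V(X)$ be sets and let $(\alpha_1,\alpha_2)\in{}^*(S_1\times S_2)$. (A) If $S_1$ is completely coherent, then the following are equivalent: 1. $(\alpha_1,\alpha_2)$ is a tensor pair; 2. $(\alpha_1,\alpha_2)\sim(\alpha_1,{}^*\alpha_2)$, i.e. the ultrafilters on $S_1\times S_2$ generated by $(\alpha_1,\alpha_2)$ (with respect to $*$) and by $(\alpha_1,{}^*\alpha_2)$ (with respect to $**$) coincide; 3. for all $A\subseteq S_1\times S_2$, if $(\alpha_1,\alpha_2)\in{}^*A$ then there is $s\in S_1$ such that $(s,\alpha_2)\in{}^*A$; 4. for all $A\subseteq S_1\times S_2$, if $(s,\alpha_2)\in{}^*A$ for all $s\in S_1$, then $(\alpha_1,\alpha_2)\in{}^*A$; 5. for all sets $S_3,S_4\in\mathbb V(X)$ and all functions $f:S_1\to S_3$, $g:S_2\to S_4$, the pair $({}^*f(\alpha_1),{}^*g(\alpha_2))$ is a tensor pair; 6. there exist sets $S_3,S_4\in\mathbb V(X)$, a bijection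 $f:S_1\to S_3$ and an injective function $g:S_2\to S_4$ such that $({}^*f(\alpha_1),{}^*g(\alpha_2))$ is a tensor pair. (B) For arbitrary $S_1$, conditions 1, 5 and 6 are equivalent to each other and to conditions 3 and 4 with ${}^*s$ written in place of $s$. -/

import Mathlib

universe u

namespace Hyperext

/-! ## Superstructures -/

/-- The levels of the superstructure over `X`: `V₀(X) = X` and `Vₙ₊₁(X) = Vₙ(X) ∪ 𝒫(Vₙ(X))`. -/
noncomputable def level (X : ZFSet.{u}) : ℕ → ZFSet.{u}
  | 0 => X
  | n + 1 => level X n ∪ ZFSet.powerset (level X n)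

/-- The superstructure `V(X) = ⋃ₙ Vₙ(X)`. -/
def V (X : ZFSet.{u}) : Set ZFSet.{u} := {a | ∃ n, a ∈ level X n}

/-- `X` is a base set: its elements play the role of atoms of `V(X)`, that is, they are nonempty
and none of their elements lies in `V(X)`. -/
def IsBaseSet (X : ZFSet.{u}) : Prop :=
  ∅ ∉ X ∧ ∀ x ∈ X, ∀ y ∈ V X, y ∉ x

/-- `S` is a set in `V(X)`, i.e. an element of `V(X)` which is not an atom. -/
def IsSetIn (X S : ZFSet.{u}) : Prop := S ∈ V X ∧ S ∉ X

/-! ## Bounded formulas and the transfer principle -/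

/-- Formulas of the language `{∈, =}` of set theory with free variables among `x₀, …, xₙ₋₁`, in
which all quantifiers are bounded. The formula `ball i φ` is `∀ y ∈ xᵢ, φ(y, x₀, …, xₙ₋₁)`
(`y` is the variable `0` of `φ`, the others are shifted by one). The remaining connectives and
the bounded existential quantifier are expressible as usual. -/
inductive BddFormula : ℕ → Type
  | mem {n : ℕ} (i j : Fin n) : BddFormula n
  | eq {n : ℕ} (i j : Fin n) : BddFormula n
  | neg {n : ℕ} (φ : BddFormula n) : BddFormula n
  | and {n : ℕ} (φ ψ : BddFormula n) : BddFormula n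
  | ball {n : ℕ} (i : Fin n) (φ : BddFormula (n + 1)) : BddFormula n

/-- Truth in `V(X)` of a bounded formula under an assignment of its free variables. -/
def BddFormula.Realize (X : ZFSet.{u}) : {n : ℕ} → BddFormula n → (Fin n → ZFSet.{u}) → Prop
  | _, .mem i j, v => v i ∈ v j
  | _, .eq i j, v => v i = v j
  | _, .neg φ, v => ¬ φ.Realize X v
  | _, .and φ ψ, v => φ.Realize X v ∧ ψ.Realize X v
  | _, .ball i φ, v => ∀ y ∈ V X, y ∈ v i → φ.Realize X (Fin.cons y v)

/-- `⟨V(X), V(X), ∗⟩` is a single superstructure model of nonstandard methods: `X` is an infinite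
(base) set and `∗ : V(X) → V(X)` satisfies the transfer principle. The map is given as a map on
all sets, of which only the restriction to `V(X)` matters. -/
structure IsSingleModel (X : ZFSet.{u}) (star : ZFSet.{u} → ZFSet.{u}) : Prop where
  infinite : {x : ZFSet.{u} | x ∈ X}.Infinite
  base : IsBaseSet X
  mapsTo : ∀ a ∈ V X, star a ∈ V X
  transfer : ∀ {n : ℕ} (φ : BddFormula n) (v : Fin n → ZFSet.{u}), (∀ i, v i ∈ V X) →
    (φ.Realize X v ↔ φ.Realize X (fun i => star (v i)))

/-! ## Functions as sets of ordered pairs -/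

/-- The value at `a` of a function `f`, given as a set of ordered pairs. -/
noncomputable def app (f a : ZFSet.{u}) : ZFSet.{u} :=
  Classical.epsilon fun b => ZFSet.pair a b ∈ f

/-- `f` is an injective function from `A` to `B`. -/
def IsInjFunc (A B f : ZFSet.{u}) : Prop :=
  ZFSet.IsFunc A B f ∧ ∀ a ∈ A, ∀ a' ∈ A, app f a = app f a' → a = a'

/-- `f` is a bijective function from `A` to `B`. -/
def IsBijFunc (A B f : ZFSet.{u}) : Prop :=
  IsInjFunc A B f ∧ ∀ b ∈ B, ∃ a ∈ A, app f a = b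

/-! ## Generated ultrafilters, tensor products, tensor pairs -/

/-- The ultrafilter on `Y` generated by `a ∈ ⋆Y`, namely `{A ⊆ Y | a ∈ ⋆A}`. Here `⋆` is a generic
extension map (for example `∗`, or its second iterate `∗∗`). -/
def generated (star : ZFSet.{u} → ZFSet.{u}) (Y a : ZFSet.{u}) : Set ZFSet.{u} :=
  {A | A ⊆ Y ∧ a ∈ star A}

/-- The tensor product `𝒰₁ ⊗ 𝒰₂` of (ultra)filters on `S₁` and `S₂`, as a family of subsets of
`S₁ × S₂`:
`A ∈ 𝒰₁ ⊗ 𝒰₂` iff `{s₁ ∈ S₁ | {s₂ ∈ S₂ | (s₁, s₂) ∈ A} ∈ 𝒰₂} ∈ 𝒰₁`. -/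
def tensor (S₁ S₂ : ZFSet.{u}) (U₁ U₂ : Set ZFSet.{u}) : Set ZFSet.{u} :=
  {A | A ⊆ ZFSet.prod S₁ S₂ ∧
    ZFSet.sep (fun s₁ => ZFSet.sep (fun s₂ => ZFSet.pair s₁ s₂ ∈ A) S₂ ∈ U₂) S₁ ∈ U₁}

/-- `(a, b) ∈ ∗(S₁ × S₂)` is a tensor pair. -/
def IsTensorPair (star : ZFSet.{u} → ZFSet.{u}) (S₁ S₂ a b : ZFSet.{u}) : Prop :=
  generated star (ZFSet.prod S₁ S₂) (ZFSet.pair a b) =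
    tensor S₁ S₂ (generated star S₁ a) (generated star S₂ b)

/-- `Y` is completely coherent: every subset `A` of `Y` is coherent, i.e. satisfies `A ⊆ ∗A`. -/
def CompletelyCoherent (star : ZFSet.{u} → ZFSet.{u}) (Y : ZFSet.{u}) : Prop :=
  ∀ A, A ⊆ Y → A ⊆ star A

end Hyperext

namespace Hyperext

open ZFSet

variable {X : ZFSet.{u}} {star : ZFSet.{u} → ZFSet.{u}}

/-! ## The superstructure -/

/-! Everything goes through `HasStarWitness`. By transfer, the section of `A` at `s` lies in the
ultrafilter of `b` iff `(∗s, b) ∈ ∗A`. Hence, with `B_A = {s ∈ S₁ | (∗s, b) ∈ ∗A}`, `(a, b)` is a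
tensor pair iff `(a, b) ∈ ∗A ↔ a ∈ ∗B_A` for all `A` (`isTensorPair_iff`).

A tensor pair has witnesses because `a ∈ ∗B_A` forces `B_A` to be nonempty. Conversely, suppose `(a,
b) ∈ ∗A` but `a ∉ ∗B_A`. Cutting `A` down to first coordinates outside `B_A` keeps `(a, b)` in the
extension, yet a witness `s` would lie both in `B_A` and outside it
(`mem_star_sep_of_hasStarWitness`). Complements give the other implication and the dual condition.

The witness property, unlike the tensor equation, moves easily along functions: preimages carry it
forward, direct images carry it back when `f` is bijective and `g` injective. Coherence serves only
to replace `∗s` by `s`; then `a ∈ ∗B_A` is, by a second transfer, `(a, ∗b) ∈ ∗∗A`. -/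

theorem level_subset_succ (X : ZFSet.{u}) (n : ℕ) : level X n ⊆ level X (n + 1) := fun _ h =>
  ZFSet.mem_union.2 (Or.inl h)

theorem level_mono (X : ZFSet.{u}) {m n : ℕ} (h : m ≤ n) : level X m ⊆ level X n := by
  induction h with
  | refl => exact fun _ h => h
  | step _ ih => exact fun _ hx => level_subset_succ X _ (ih hx)

theorem mem_level_of_mem_of_mem_level {n : ℕ} {a b : ZFSet.{u}} (ha : a ∈ level X n)
    (haX : a ∉ X) (hb : b ∈ a) : b ∈ level X n := by
  induction n with
  | zero => exact absurd ha haX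
  | succ n ih =>
    rcases ZFSet.mem_union.1 ha with h | h
    · exact level_subset_succ X n (ih h)
    · exact level_subset_succ X n (ZFSet.mem_powerset.1 h hb)

theorem mem_V_of_mem {a b : ZFSet.{u}} (ha : a ∈ V X) (haX : a ∉ X) (hb : b ∈ a) : b ∈ V X :=
  let ⟨n, hn⟩ := ha
  ⟨n, mem_level_of_mem_of_mem_level hn haX hb⟩

theorem mem_V_of_subset_level {n : ℕ} {a : ZFSet.{u}} (ha : a ⊆ level X n) : a ∈ V X :=
  ⟨n + 1, ZFSet.mem_union.2 (Or.inr (ZFSet.mem_powerset.2 ha))⟩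

theorem IsSetIn.subset_level {S : ZFSet.{u}} (hS : IsSetIn X S) : ∃ n, S ⊆ level X n :=
  let ⟨n, hn⟩ := hS.1
  ⟨n, fun _ hb => mem_level_of_mem_of_mem_level hn hS.2 hb⟩

theorem IsSetIn.mem_V_of_subset {S A : ZFSet.{u}} (hS : IsSetIn X S) (hA : A ⊆ S) : A ∈ V X :=
  let ⟨_, hn⟩ := hS.subset_level
  mem_V_of_subset_level fun _ h => hn (hA h)

theorem IsSetIn.mem_V {S s : ZFSet.{u}} (hS : IsSetIn X S) (hs : s ∈ S) : s ∈ V X :=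
  mem_V_of_mem hS.1 hS.2 hs

/-- An element of `V(X)` with an element in `V(X)` is not an atom, so all its elements are in
`V(X)`. -/
theorem IsBaseSet.mem_V_of_mem (hX : IsBaseSet X) {a b c : ZFSet.{u}} (ha : a ∈ V X)
    (hb : b ∈ V X) (hba : b ∈ a) (hc : c ∈ a) : c ∈ V X :=
  Hyperext.mem_V_of_mem ha (fun haX => hX.2 a haX b hb hba) hc

theorem insert_mem_level {n : ℕ} {a b : ZFSet.{u}} (ha : a ∈ level X n) (hb : b ∈ level X n) :
    ({a, b} : ZFSet.{u}) ∈ level X (n + 1) := by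
  refine ZFSet.mem_union.2 (Or.inr (ZFSet.mem_powerset.2 fun z hz => ?_))
  rcases ZFSet.mem_pair.1 hz with rfl | rfl <;> assumption

/-- With the singleton written as `{a, a}`, unordered pairs are the only construction that a formula
for ordered pairs has to express. -/
theorem pair_eq_insert (a b : ZFSet.{u}) : ZFSet.pair a b = {{a, a}, {a, b}} := by
  simp [ZFSet.pair]

theorem pair_mem_level {n : ℕ} {a b : ZFSet.{u}} (ha : a ∈ level X n) (hb : b ∈ level X n) :
    ZFSet.pair a b ∈ level X (n + 2) := by
  rw [pair_eq_insert]
  exact insert_mem_level (insert_mem_level ha ha) (insert_mem_level ha hb)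

theorem insert_mem_V {a b : ZFSet.{u}} (ha : a ∈ V X) (hb : b ∈ V X) :
    ({a, b} : ZFSet.{u}) ∈ V X := by
  obtain ⟨m, hm⟩ := ha
  obtain ⟨n, hn⟩ := hb
  exact ⟨_, insert_mem_level (level_mono X (le_max_left m n) hm)
    (level_mono X (le_max_right m n) hn)⟩

theorem pair_mem_V {a b : ZFSet.{u}} (ha : a ∈ V X) (hb : b ∈ V X) : ZFSet.pair a b ∈ V X := by
  rw [pair_eq_insert]
  exact insert_mem_V (insert_mem_V ha ha) (insert_mem_V ha hb)

/-- An atom is nonempty and has no element in `V(X)`, so no subset of a level can be an atom. -/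
theorem IsBaseSet.isSetIn_of_subset_level (hX : IsBaseSet X) {n : ℕ} {a : ZFSet.{u}}
    (ha : a ⊆ level X n) : IsSetIn X a := by
  refine ⟨mem_V_of_subset_level ha, fun haX => ?_⟩
  obtain ⟨b, hb⟩ : a.Nonempty :=
    (ZFSet.eq_empty_or_nonempty a).resolve_left fun h => hX.1 (h ▸ haX)
  exact hX.2 a haX b ⟨n, ha hb⟩ hb

theorem IsBaseSet.isSetIn_prod (hX : IsBaseSet X) {S T : ZFSet.{u}} (hS : IsSetIn X S)
    (hT : IsSetIn X T) : IsSetIn X (ZFSet.prod S T) := by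
  obtain ⟨m, hm⟩ := hS.subset_level
  obtain ⟨n, hn⟩ := hT.subset_level
  refine hX.isSetIn_of_subset_level (n := max m n + 2) fun p hp => ?_
  obtain ⟨a, ha, b, hb, rfl⟩ := ZFSet.mem_prod.1 hp
  exact pair_mem_level (level_mono X (le_max_left m n) (hm ha))
    (level_mono X (le_max_right m n) (hn hb))

theorem IsBaseSet.snd_mem_V (hX : IsBaseSet X) {a b : ZFSet.{u}}
    (h : ZFSet.pair a b ∈ V X) (ha : a ∈ V X) : b ∈ V X := by
  have haa : ({a, a} : ZFSet.{u}) ∈ V X := insert_mem_V ha ha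
  rw [pair_eq_insert] at h
  have hab : ({a, b} : ZFSet.{u}) ∈ V X :=
    hX.mem_V_of_mem h haa (ZFSet.mem_pair.2 (Or.inl rfl)) (ZFSet.mem_pair.2 (Or.inr rfl))
  exact hX.mem_V_of_mem hab ha (ZFSet.mem_pair.2 (Or.inl rfl)) (ZFSet.mem_pair.2 (Or.inr rfl))

/-! ## Derived bounded formulas -/

namespace BddFormula

/-- Truth of a bounded formula under an assignment in the subtype of elements of `V(X)`. -/
def Holds {n : ℕ} (φ : BddFormula n) (v : Fin n → V X) : Prop :=
  φ.Realize X fun i => v i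

/-- Implication. -/
def imp {n : ℕ} (φ ψ : BddFormula n) : BddFormula n := .neg (.and φ (.neg ψ))

/-- Equivalence. -/
def iff {n : ℕ} (φ ψ : BddFormula n) : BddFormula n := .and (imp φ ψ) (imp ψ φ)

/-- Bounded existential quantification. -/
def bex {n : ℕ} (i : Fin n) (φ : BddFormula (n + 1)) : BddFormula n := .neg (.ball i (.neg φ))

/-- The formula `xᵢ = {xⱼ, xₖ}`. -/
def isInsert {n : ℕ} (i j k : Fin n) : BddFormula n :=
  .and (.mem j i) (.and (.mem k i) (.ball i (imp (.neg (.eq 0 j.succ)) (.eq 0 k.succ))))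

/-- The formula `xᵢ = (xⱼ, xₖ)`. -/
def isPair {n : ℕ} (i j k : Fin n) : BddFormula n :=
  bex i (bex i.succ (.and (isInsert 1 j.succ.succ j.succ.succ)
    (.and (isInsert 0 j.succ.succ k.succ.succ) (isInsert i.succ.succ 1 0))))

/-- The formula `(xᵢ, xⱼ) ∈ xₖ`. -/
def pairMem {n : ℕ} (i j k : Fin n) : BddFormula n := bex k (isPair 0 i.succ j.succ)

section Holds

variable {n : ℕ} (v : Fin n → V X)

@[simp]
theorem holds_mem (i j : Fin n) : (mem i j).Holds v ↔ (v i : ZFSet.{u}) ∈ (v j : ZFSet.{u}) :=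
  Iff.rfl

@[simp]
theorem holds_eq (i j : Fin n) : (eq i j).Holds v ↔ v i = v j :=
  Subtype.ext_iff.symm

@[simp]
theorem holds_neg (φ : BddFormula n) : (neg φ).Holds v ↔ ¬ φ.Holds v :=
  Iff.rfl

@[simp]
theorem holds_and (φ ψ : BddFormula n) : (and φ ψ).Holds v ↔ φ.Holds v ∧ ψ.Holds v :=
  Iff.rfl

@[simp]
theorem holds_ball (i : Fin n) (φ : BddFormula (n + 1)) :
    (ball i φ).Holds v ↔
      ∀ y : V X, (y : ZFSet.{u}) ∈ (v i : ZFSet.{u}) → φ.Holds (Matrix.vecCons y v) := by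
  -- Coercion commutes with extending the assignment; the `Matrix.vecCons` form lets `simp` look up
  -- variables in `![…]`.
  have key : ∀ y : V X, (Fin.cons (y : ZFSet.{u}) fun i => (v i : ZFSet.{u})) =
      fun i => ((Matrix.vecCons y v i : V X) : ZFSet.{u}) := fun y => by
    funext i
    refine Fin.cases ?_ (fun i => ?_) i <;> rfl
  constructor
  · intro h y hy
    have := h y y.2 hy
    rwa [key] at this
  · intro h y hyV hy
    have := h ⟨y, hyV⟩ hy
    rwa [Holds, ← key] at this

@[simp]
theorem holds_imp (φ ψ : BddFormula n) : (imp φ ψ).Holds v ↔ (φ.Holds v → ψ.Holds v) := by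
  simp [imp]

@[simp]
theorem holds_iff (φ ψ : BddFormula n) : (iff φ ψ).Holds v ↔ (φ.Holds v ↔ ψ.Holds v) := by
  simp [iff, iff_iff_implies_and_implies]

@[simp]
theorem holds_bex (i : Fin n) (φ : BddFormula (n + 1)) :
    (bex i φ).Holds v ↔
      ∃ y : V X, (y : ZFSet.{u}) ∈ (v i : ZFSet.{u}) ∧ φ.Holds (Matrix.vecCons y v) := by
  simp [bex]

/-- The bounded quantifier sees only elements in `V(X)`. This suffices: a member of `V(X)`
containing `xⱼ ∈ V(X)` is no atom, so all its elements lie in `V(X)`. -/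
theorem holds_isInsert (hX : IsBaseSet X) (i j k : Fin n) :
    (isInsert i j k).Holds v ↔ (v i : ZFSet.{u}) = {(v j : ZFSet.{u}), (v k : ZFSet.{u})} := by
  simp only [isInsert, holds_and, holds_mem, holds_ball, holds_imp, holds_neg, holds_eq,
    Matrix.cons_val_zero, Matrix.cons_val_succ]
  constructor
  · rintro ⟨hj, hk, h⟩
    ext z
    rw [ZFSet.mem_pair]
    refine ⟨fun hz => ?_, ?_⟩
    · have hzV : z ∈ V X := hX.mem_V_of_mem (v i).2 (v j).2 hj hz
      have := h ⟨z, hzV⟩ hz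
      rw [Subtype.ext_iff, Subtype.ext_iff] at this
      exact or_iff_not_imp_left.2 this
    · rintro (rfl | rfl) <;> assumption
  · intro h
    rw [h]
    refine ⟨ZFSet.mem_pair.2 (Or.inl rfl), ZFSet.mem_pair.2 (Or.inr rfl), fun y hy hne => ?_⟩
    exact Subtype.ext ((ZFSet.mem_pair.1 hy).resolve_left fun h => hne (Subtype.ext h))

theorem holds_isPair (hX : IsBaseSet X) (i j k : Fin n) :
    (isPair i j k).Holds v ↔
      (v i : ZFSet.{u}) = ZFSet.pair (v j : ZFSet.{u}) (v k : ZFSet.{u}) := by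
  simp only [isPair, holds_bex, holds_and, holds_isInsert _ hX, Matrix.cons_val_zero,
    Matrix.cons_val_one, Matrix.cons_val_succ, pair_eq_insert]
  constructor
  · rintro ⟨y, -, z, -, hy, hz, h⟩
    rw [h, hy, hz]
  · intro h
    refine ⟨⟨_, insert_mem_V (v j).2 (v j).2⟩, ?_, ⟨_, insert_mem_V (v j).2 (v k).2⟩, ?_,
      rfl, rfl, h⟩ <;> rw [h] <;> simp

theorem holds_pairMem (hX : IsBaseSet X) (i j k : Fin n) :
    (pairMem i j k).Holds v ↔
      ZFSet.pair (v i : ZFSet.{u}) (v j : ZFSet.{u}) ∈ (v k : ZFSet.{u}) := by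
  simp only [pairMem, holds_bex, holds_isPair _ hX, Matrix.cons_val_zero, Matrix.cons_val_succ]
  constructor
  · rintro ⟨y, hy, h⟩
    rwa [← h]
  · exact fun h => ⟨⟨_, pair_mem_V (v i).2 (v j).2⟩, h, rfl⟩

end Holds

end BddFormula

/-! ## Instances of transfer -/

namespace IsSingleModel

open BddFormula

/-- The restriction of `∗` to `V(X)`. -/
def starV (hm : IsSingleModel X star) (a : V X) : V X := ⟨star a, hm.mapsTo a a.2⟩

theorem holds_starV (hm : IsSingleModel X star) {n : ℕ} (φ : BddFormula n) (v : Fin n → V X) :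
    φ.Holds v ↔ φ.Holds (hm.starV ∘ v) :=
  hm.transfer φ (fun i => v i) fun i => (v i).2

variable {A B C F G P S T S' T' a b c s t : ZFSet.{u}}

theorem pair_mem_star_iff (hm : IsSingleModel X star) (ha : a ∈ V X) (hb : b ∈ V X)
    (hF : F ∈ V X) :
    ZFSet.pair (star a) (star b) ∈ star F ↔ ZFSet.pair a b ∈ F := by
  have h := hm.holds_starV (pairMem 0 1 2) ![⟨a, ha⟩, ⟨b, hb⟩, ⟨F, hF⟩]
  simp only [holds_pairMem _ hm.base] at h
  exact h.symm

theorem star_mem_star (hm : IsSingleModel X star) (ha : a ∈ V X) (hb : b ∈ V X) (hab : a ∈ b) :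
    star a ∈ star b := by
  have h := hm.holds_starV (.mem 0 1) ![⟨a, ha⟩, ⟨b, hb⟩]
  simp only [holds_mem] at h
  exact h.1 hab

theorem notMem_star_empty (hm : IsSingleModel X star) (hB : B ∈ V X) (h : ∀ y, y ∉ B)
    (ha : a ∈ V X) : a ∉ star B := by
  have := (hm.holds_starV (.ball 0 (.neg (.mem 0 1))) ![⟨B, hB⟩]).1 (by simp [h])
  simp only [holds_ball] at this
  exact fun haB => this ⟨a, ha⟩ haB haB

theorem mem_star_of_subset (hm : IsSingleModel X star) (hA : A ∈ V X) (hB : B ∈ V X)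
    (hAB : A ⊆ B) (ha : a ∈ V X) (haA : a ∈ star A) : a ∈ star B := by
  have := (hm.holds_starV (.ball 0 (.mem 0 2)) ![⟨A, hA⟩, ⟨B, hB⟩]).1 (by
    simp only [holds_ball]
    exact fun y hy => hAB hy)
  simp only [holds_ball] at this
  exact this ⟨a, ha⟩ haA

/-- Transferring `∀ y ∈ {a}, y = a` shows that `∗a` is the only possible element of `∗{a}` in
`V(X)`. -/
theorem eq_star_of_mem_star_singleton (hm : IsSingleModel X star) (ha : a ∈ V X)
    (haa : a ∈ star {a, a}) : star a = a := by
  have := (hm.holds_starV (.ball 1 (.eq 0 1)) ![⟨a, ha⟩, ⟨{a, a}, insert_mem_V ha ha⟩]).1 (by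
    simp only [holds_ball]
    intro y hy
    simpa [Subtype.ext_iff] using hy)
  simp only [holds_ball, holds_eq] at this
  exact (Subtype.ext_iff.1 (this ⟨a, ha⟩ haa)).symm

theorem pair_mem_star_prod_iff (hm : IsSingleModel X star) (hS : IsSetIn X S)
    (hT : IsSetIn X T) (ha : a ∈ V X) (hb : b ∈ V X) :
    ZFSet.pair a b ∈ star (ZFSet.prod S T) ↔ a ∈ star S ∧ b ∈ star T := by
  have hP := hm.base.isSetIn_prod hS hT
  constructor
  · intro h
    -- Each quantifier shifts the parameters by one: `2` and `4` denote `S` and `T`, and in the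
    -- matrix `2, 1, 0` are `p, s, t`.
    have := (hm.holds_starV (.ball 0 (bex 2 (bex 4 (isPair 2 1 0))))
      ![⟨_, hP.1⟩, ⟨S, hS.1⟩, ⟨T, hT.1⟩]).1 (by
        simp only [holds_ball, holds_bex, holds_isPair _ hm.base]
        intro p hp
        obtain ⟨s, hs, t, ht, e⟩ := ZFSet.mem_prod.1 hp
        exact ⟨⟨s, hS.mem_V hs⟩, hs, ⟨t, hT.mem_V ht⟩, ht, e⟩)
    simp only [holds_ball, holds_bex, holds_isPair _ hm.base] at this
    obtain ⟨s, hs, t, ht, e⟩ := this ⟨_, pair_mem_V ha hb⟩ h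
    obtain ⟨has, hbt⟩ := ZFSet.pair_inj.1 e
    exact ⟨has ▸ hs, hbt ▸ ht⟩
  · rintro ⟨haS, hbT⟩
    have := (hm.holds_starV (.ball 1 (.ball 3 (pairMem 1 0 2)))
      ![⟨_, hP.1⟩, ⟨S, hS.1⟩, ⟨T, hT.1⟩]).1 (by
        simp only [holds_ball, holds_pairMem _ hm.base]
        exact fun s hs t ht => ZFSet.pair_mem_prod.2 ⟨hs, ht⟩)
    simp only [holds_ball, holds_pairMem _ hm.base] at this
    exact this ⟨a, ha⟩ haS ⟨b, hb⟩ hbT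

theorem mem_star_compl_iff (hm : IsSingleModel X star) (hS : S ∈ V X) (hA : A ∈ V X)
    (hB : B ∈ V X) (h : ∀ s ∈ S, (s ∈ B ↔ s ∉ A)) (ha : a ∈ V X) (haS : a ∈ star S) :
    a ∈ star B ↔ a ∉ star A := by
  have := (hm.holds_starV (.ball 0 (.iff (.mem 0 3) (.neg (.mem 0 2))))
    ![⟨S, hS⟩, ⟨A, hA⟩, ⟨B, hB⟩]).1 (by
      simp only [holds_ball, holds_iff, holds_neg, holds_mem]
      exact fun s hs => h s hs)
  simp only [holds_ball, holds_iff, holds_neg, holds_mem] at this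
  exact this ⟨a, ha⟩ haS

/-- Transfer of `∀ t ∈ T, t ∈ C ↔ (s, t) ∈ A`. -/
theorem mem_star_section_iff (hm : IsSingleModel X star) (hT : T ∈ V X) (hC : C ∈ V X)
    (hs : s ∈ V X) (hA : A ∈ V X) (h : ∀ t ∈ T, (t ∈ C ↔ ZFSet.pair s t ∈ A))
    (hb : b ∈ V X) (hbT : b ∈ star T) :
    b ∈ star C ↔ ZFSet.pair (star s) b ∈ star A := by
  have := (hm.holds_starV (.ball 0 (.iff (.mem 0 2) (pairMem 3 0 4)))
    ![⟨T, hT⟩, ⟨C, hC⟩, ⟨s, hs⟩, ⟨A, hA⟩]).1 (by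
      simp only [holds_ball, holds_iff, holds_pairMem _ hm.base, holds_mem]
      exact fun t ht => h t ht)
  simp only [holds_ball, holds_iff, holds_pairMem _ hm.base, holds_mem] at this
  exact this ⟨b, hb⟩ hbT

/-- Transfer of `∀ s ∈ S, s ∈ C ↔ (s, t) ∈ A`. -/
theorem mem_star_section_iff' (hm : IsSingleModel X star) (hS : S ∈ V X) (hC : C ∈ V X)
    (ht : t ∈ V X) (hA : A ∈ V X) (h : ∀ s ∈ S, (s ∈ C ↔ ZFSet.pair s t ∈ A))
    (ha : a ∈ V X) (haS : a ∈ star S) :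
    a ∈ star C ↔ ZFSet.pair a (star t) ∈ star A := by
  have := (hm.holds_starV (.ball 0 (.iff (.mem 0 2) (pairMem 0 3 4)))
    ![⟨S, hS⟩, ⟨C, hC⟩, ⟨t, ht⟩, ⟨A, hA⟩]).1 (by
      simp only [holds_ball, holds_iff, holds_pairMem _ hm.base, holds_mem]
      exact fun s hs => h s hs)
  simp only [holds_ball, holds_iff, holds_pairMem _ hm.base, holds_mem] at this
  exact this ⟨a, ha⟩ haS

/-- Transfer of `∀ s ∈ S, ∀ t ∈ T, (s, t) ∈ B ↔ (s, t) ∈ A ∧ s ∈ C`. -/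
theorem pair_mem_star_restrict_iff (hm : IsSingleModel X star) (hS : S ∈ V X) (hT : T ∈ V X)
    (hA : A ∈ V X) (hB : B ∈ V X) (hC : C ∈ V X)
    (h : ∀ s ∈ S, ∀ t ∈ T, (ZFSet.pair s t ∈ B ↔ ZFSet.pair s t ∈ A ∧ s ∈ C))
    (ha : a ∈ V X) (haS : a ∈ star S) (hb : b ∈ V X) (hbT : b ∈ star T) :
    ZFSet.pair a b ∈ star B ↔ ZFSet.pair a b ∈ star A ∧ a ∈ star C := by
  have := (hm.holds_starV
    (.ball 0 (.ball 2 (.iff (pairMem 1 0 5) (.and (pairMem 1 0 4) (.mem 1 6)))))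
    ![⟨S, hS⟩, ⟨T, hT⟩, ⟨A, hA⟩, ⟨B, hB⟩, ⟨C, hC⟩]).1 (by
      simp only [holds_ball, holds_iff, holds_and, holds_pairMem _ hm.base, holds_mem]
      exact fun s hs t ht => h s hs t ht)
  simp only [holds_ball, holds_iff, holds_and, holds_pairMem _ hm.base, holds_mem] at this
  exact this ⟨a, ha⟩ haS ⟨b, hb⟩ hbT

/-- Transfer of `(s, t) ∈ A ↔ (f(s), g(t)) ∈ B`. -/
theorem pair_mem_star_preimage_iff (hm : IsSingleModel X star) (hS : S ∈ V X) (hT : T ∈ V X)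
    (hS' : S' ∈ V X) (hT' : T' ∈ V X) (hF : F ∈ V X) (hG : G ∈ V X) (hA : A ∈ V X)
    (hB : B ∈ V X)
    (h : ∀ s ∈ S, ∀ t ∈ T, ∀ s' ∈ S', ∀ t' ∈ T', ZFSet.pair s s' ∈ F → ZFSet.pair t t' ∈ G →
      (ZFSet.pair s t ∈ A ↔ ZFSet.pair s' t' ∈ B))
    {a' b' : ZFSet.{u}} (ha : a ∈ V X) (haS : a ∈ star S) (hb : b ∈ V X) (hbT : b ∈ star T)
    (ha' : a' ∈ V X) (haS' : a' ∈ star S') (hb' : b' ∈ V X) (hbT' : b' ∈ star T')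
    (hF' : ZFSet.pair a a' ∈ star F) (hG' : ZFSet.pair b b' ∈ star G) :
    ZFSet.pair a b ∈ star A ↔ ZFSet.pair a' b' ∈ star B := by
  have := (hm.holds_starV
    (.ball 0 (.ball 2 (.ball 4 (.ball 6 (imp (pairMem 3 1 8) (imp (pairMem 2 0 9)
      (.iff (pairMem 3 2 10) (pairMem 1 0 11))))))))
    ![⟨S, hS⟩, ⟨T, hT⟩, ⟨S', hS'⟩, ⟨T', hT'⟩, ⟨F, hF⟩, ⟨G, hG⟩, ⟨A, hA⟩, ⟨B, hB⟩]).1 (by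
      simp only [holds_ball, holds_iff, holds_imp, holds_pairMem _ hm.base]
      exact fun s hs t ht s' hs' t' ht' => h s hs t ht s' hs' t' ht')
  simp only [holds_ball, holds_iff, holds_imp, holds_pairMem _ hm.base] at this
  exact this ⟨a, ha⟩ haS ⟨b, hb⟩ hbT ⟨a', ha'⟩ haS' ⟨b', hb'⟩ hbT' hF' hG'

theorem exists_pair_mem_star (hm : IsSingleModel X star) (hS : IsSetIn X S) (hT : IsSetIn X T)
    (hF : IsFunc S T F) (ha : a ∈ V X) (haS : a ∈ star S) :
    ∃ b ∈ V X, b ∈ star T ∧ ZFSet.pair a b ∈ star F := by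
  have hFV : F ∈ V X := (hm.base.isSetIn_prod hS hT).mem_V_of_subset hF.1
  have := (hm.holds_starV (.ball 0 (bex 2 (pairMem 1 0 4)))
    ![⟨S, hS.1⟩, ⟨T, hT.1⟩, ⟨F, hFV⟩]).1 (by
      simp only [holds_ball, holds_bex, holds_pairMem _ hm.base]
      intro s hs
      obtain ⟨t, ht, -⟩ := hF.2 s hs
      have htT := (ZFSet.pair_mem_prod.1 (hF.1 ht)).2
      exact ⟨⟨t, hT.mem_V htT⟩, htT, ht⟩)
  simp only [holds_ball, holds_bex, holds_pairMem _ hm.base] at this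
  obtain ⟨b, hb, h⟩ := this ⟨a, ha⟩ haS
  exact ⟨b, b.2, hb, h⟩

theorem eq_of_pair_mem_star (hm : IsSingleModel X star) (hS : IsSetIn X S) (hT : IsSetIn X T)
    (hF : IsFunc S T F) (ha : a ∈ V X) (hb : b ∈ V X) (hc : c ∈ V X) (haS : a ∈ star S)
    (hbT : b ∈ star T) (hcT : c ∈ star T) (hab : ZFSet.pair a b ∈ star F)
    (hac : ZFSet.pair a c ∈ star F) : b = c := by
  have hFV : F ∈ V X := (hm.base.isSetIn_prod hS hT).mem_V_of_subset hF.1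
  have := (hm.holds_starV
    (.ball 0 (.ball 2 (.ball 3 (imp (pairMem 2 1 5) (imp (pairMem 2 0 5) (.eq 1 0))))))
    ![⟨S, hS.1⟩, ⟨T, hT.1⟩, ⟨F, hFV⟩]).1 (by
      simp only [holds_ball, holds_imp, holds_pairMem _ hm.base, holds_eq]
      exact fun s hs t _ t' _ h h' => Subtype.ext ((hF.2 s hs).unique h h'))
  simp only [holds_ball, holds_imp, holds_pairMem _ hm.base, holds_eq] at this
  exact Subtype.ext_iff.1 (this ⟨a, ha⟩ haS ⟨b, hb⟩ hbT ⟨c, hc⟩ hcT hab hac)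

/-- The value of `∗f` at `a ∈ ∗S`, for a function `f` from `S` to `T`. -/
theorem app_star_spec (hm : IsSingleModel X star) (hS : IsSetIn X S) (hT : IsSetIn X T)
    (hF : IsFunc S T F) (ha : a ∈ V X) (haS : a ∈ star S) :
    app (star F) a ∈ V X ∧ app (star F) a ∈ star T ∧
      ZFSet.pair a (app (star F) a) ∈ star F := by
  have hFV : F ∈ V X := (hm.base.isSetIn_prod hS hT).mem_V_of_subset hF.1
  obtain ⟨b, hb, hbT, hab⟩ := hm.exists_pair_mem_star hS hT hF ha haS
  -- The choice in `app` ranges over all sets, so its value is not yet known to be in `V(X)`. As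
  -- `∗F` contains a pair from `V(X)`, it is no atom, and membership descends from `∗F` to the
  -- chosen value.
  have hmem : ZFSet.pair a (app (star F) a) ∈ star F :=
    Classical.epsilon_spec (p := fun b => ZFSet.pair a b ∈ star F) ⟨b, hab⟩
  have hpV := hm.base.mem_V_of_mem (hm.mapsTo F hFV) (pair_mem_V ha hb) hab hmem
  have hV := hm.base.snd_mem_V hpV ha
  exact ⟨hV, ((hm.pair_mem_star_prod_iff hS hT ha hV).1 (hm.mem_star_of_subset hFV
    (hm.base.isSetIn_prod hS hT).1 hF.1 hpV hmem)).2, hmem⟩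

end IsSingleModel

variable {S₁ S₂ S₃ S₄ a b f g : ZFSet.{u}}

/-! ## Functions as sets of ordered pairs -/

theorem pair_app_mem (hf : ZFSet.IsFunc S₁ S₂ f) (ha : a ∈ S₁) : ZFSet.pair a (app f a) ∈ f :=
  Classical.epsilon_spec (p := fun b => ZFSet.pair a b ∈ f) (hf.2 a ha).exists

theorem app_eq_of_pair_mem (hf : ZFSet.IsFunc S₁ S₂ f) (hab : ZFSet.pair a b ∈ f) :
    app f a = b := by
  have ha := (ZFSet.pair_mem_prod.1 (hf.1 hab)).1
  exact (hf.2 a ha).unique (pair_app_mem hf ha) hab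

theorem app_mem (hf : ZFSet.IsFunc S₁ S₂ f) (ha : a ∈ S₁) : app f a ∈ S₂ :=
  (ZFSet.pair_mem_prod.1 (hf.1 (pair_app_mem hf ha))).2

/-- The identity function of `S`. -/
noncomputable def idFunc (S : ZFSet.{u}) : ZFSet.{u} :=
  ZFSet.sep (fun p => ∃ s, p = ZFSet.pair s s) (ZFSet.prod S S)

theorem pair_mem_idFunc : ZFSet.pair a b ∈ idFunc S₁ ↔ a ∈ S₁ ∧ a = b := by
  rw [idFunc, ZFSet.mem_sep, ZFSet.pair_mem_prod]
  constructor
  · rintro ⟨⟨ha, -⟩, s, hs⟩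
    obtain ⟨rfl, rfl⟩ := ZFSet.pair_inj.1 hs
    exact ⟨ha, rfl⟩
  · rintro ⟨ha, rfl⟩
    exact ⟨⟨ha, ha⟩, a, rfl⟩

theorem isFunc_idFunc (S : ZFSet.{u}) : ZFSet.IsFunc S S (idFunc S) :=
  ⟨fun _ hp => (ZFSet.mem_sep.1 hp).1, fun s hs =>
    ⟨s, pair_mem_idFunc.2 ⟨hs, rfl⟩, fun _ h => (pair_mem_idFunc.1 h).2.symm⟩⟩

theorem app_idFunc (ha : a ∈ S₁) : app (idFunc S₁) a = a :=
  app_eq_of_pair_mem (isFunc_idFunc S₁) (pair_mem_idFunc.2 ⟨ha, rfl⟩)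

theorem isBijFunc_idFunc (S : ZFSet.{u}) : IsBijFunc S S (idFunc S) :=
  ⟨⟨isFunc_idFunc S, fun a ha a' ha' h => by rwa [app_idFunc ha, app_idFunc ha'] at h⟩,
    fun b hb => ⟨b, hb, app_idFunc hb⟩⟩

/-! ## Characterizations of tensor pairs -/

/-- Every subset of `S₁ × S₂` whose extension contains `(a, b)` has an extension containing
`(∗s, b)` for some `s ∈ S₁`. -/
def HasStarWitness (star : ZFSet.{u} → ZFSet.{u}) (S₁ S₂ a b : ZFSet.{u}) : Prop :=
  ∀ A, A ⊆ ZFSet.prod S₁ S₂ → ZFSet.pair a b ∈ star A →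
    ∃ s ∈ S₁, ZFSet.pair (star s) b ∈ star A

namespace IsSingleModel

/-- Transferring the definition of the section of `A` at `s` turns the inner ultrafilter condition
into `(∗s, b) ∈ ∗A`. -/
theorem mem_tensor_generated_iff (hm : IsSingleModel X star) (h₁ : IsSetIn X S₁)
    (h₂ : IsSetIn X S₂) (hb : b ∈ V X) (hbS : b ∈ star S₂) {A : ZFSet.{u}} :
    A ∈ tensor S₁ S₂ (generated star S₁ a) (generated star S₂ b) ↔
      A ⊆ ZFSet.prod S₁ S₂ ∧
        a ∈ star (ZFSet.sep (fun s => ZFSet.pair (star s) b ∈ star A) S₁) := by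
  refine and_congr_right fun hA => ?_
  have hAV : A ∈ V X := (hm.base.isSetIn_prod h₁ h₂).mem_V_of_subset hA
  have hsep : ZFSet.sep (fun s₁ =>
      ZFSet.sep (fun s₂ => ZFSet.pair s₁ s₂ ∈ A) S₂ ∈ generated star S₂ b) S₁ =
      ZFSet.sep (fun s => ZFSet.pair (star s) b ∈ star A) S₁ := by
    ext s
    rw [ZFSet.mem_sep, ZFSet.mem_sep]
    refine and_congr_right fun hs => ?_
    have hC : ZFSet.sep (fun s₂ => ZFSet.pair s s₂ ∈ A) S₂ ⊆ S₂ := ZFSet.sep_subset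
    rw [← hm.mem_star_section_iff h₂.1 (h₂.mem_V_of_subset hC) (h₁.mem_V hs) hAV
      (fun t ht => by simp [ht]) hb hbS]
    exact and_iff_right hC
  rw [hsep]
  exact and_iff_right ZFSet.sep_subset

theorem isTensorPair_iff (hm : IsSingleModel X star) (h₁ : IsSetIn X S₁) (h₂ : IsSetIn X S₂)
    (hb : b ∈ V X) (hbS : b ∈ star S₂) :
    IsTensorPair star S₁ S₂ a b ↔ ∀ A, A ⊆ ZFSet.prod S₁ S₂ →
      (ZFSet.pair a b ∈ star A ↔
        a ∈ star (ZFSet.sep (fun s => ZFSet.pair (star s) b ∈ star A) S₁)) := by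
  rw [IsTensorPair, Set.ext_iff]
  refine forall_congr' fun A => ?_
  rw [hm.mem_tensor_generated_iff h₁ h₂ hb hbS]
  exact and_congr_right_iff

theorem pair_mem_star_diff_iff (hm : IsSingleModel X star) (h₁ : IsSetIn X S₁)
    (h₂ : IsSetIn X S₂) (ha : a ∈ V X) (haS : a ∈ star S₁) (hb : b ∈ V X) (hbS : b ∈ star S₂)
    {A : ZFSet.{u}} (hA : A ⊆ ZFSet.prod S₁ S₂) :
    ZFSet.pair a b ∈ star (ZFSet.prod S₁ S₂ \ A) ↔ ZFSet.pair a b ∉ star A := by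
  have hP := hm.base.isSetIn_prod h₁ h₂
  exact hm.mem_star_compl_iff hP.1 (hP.mem_V_of_subset hA)
    (hP.mem_V_of_subset fun _ h => (ZFSet.mem_sdiff.1 h).1)
    (fun s hs => by rw [ZFSet.mem_sdiff, and_iff_right hs]) (pair_mem_V ha hb)
    ((hm.pair_mem_star_prod_iff h₁ h₂ ha hb).2 ⟨haS, hbS⟩)

theorem hasStarWitness_of_isTensorPair (hm : IsSingleModel X star) (h₁ : IsSetIn X S₁)
    (h₂ : IsSetIn X S₂) (ha : a ∈ V X) (hb : b ∈ V X) (hbS : b ∈ star S₂)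
    (h : IsTensorPair star S₁ S₂ a b) : HasStarWitness star S₁ S₂ a b := by
  intro A hA hab
  rw [hm.isTensorPair_iff h₁ h₂ hb hbS] at h
  by_contra! hne
  refine hm.notMem_star_empty (h₁.mem_V_of_subset ZFSet.sep_subset) (fun s hs => ?_) ha
    ((h A hA).1 hab)
  obtain ⟨hs, hsA⟩ := ZFSet.mem_sep.1 hs
  exact hne s hs hsA

theorem mem_star_sep_of_hasStarWitness (hm : IsSingleModel X star) (h₁ : IsSetIn X S₁)
    (h₂ : IsSetIn X S₂) (ha : a ∈ V X) (haS : a ∈ star S₁) (hb : b ∈ V X) (hbS : b ∈ star S₂)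
    (h : HasStarWitness star S₁ S₂ a b) {A : ZFSet.{u}} (hA : A ⊆ ZFSet.prod S₁ S₂)
    (hab : ZFSet.pair a b ∈ star A) :
    a ∈ star (ZFSet.sep (fun s => ZFSet.pair (star s) b ∈ star A) S₁) := by
  set B := ZFSet.sep (fun s => ZFSet.pair (star s) b ∈ star A) S₁ with hB
  have hP := hm.base.isSetIn_prod h₁ h₂
  have hBV : B ∈ V X := h₁.mem_V_of_subset ZFSet.sep_subset
  have hDV : S₁ \ B ∈ V X := h₁.mem_V_of_subset fun _ h => (ZFSet.mem_sdiff.1 h).1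
  have hD : ∀ {a}, a ∈ V X → a ∈ star S₁ → (a ∈ star (S₁ \ B) ↔ a ∉ star B) := fun ha haS =>
    hm.mem_star_compl_iff h₁.1 hBV hDV (fun s hs => by rw [ZFSet.mem_sdiff, and_iff_right hs])
      ha haS
  by_contra haB
  -- `A'` discards exactly the pairs whose first coordinate could be a witness for `A`; a witness
  -- `s` for `A'` then gives `∗s ∉ ∗B` although `s ∈ B`.
  set A' := ZFSet.sep (fun p => ∃ s ∈ S₁ \ B, ∃ t, p = ZFSet.pair s t) A with hA'
  have hA'P : A' ⊆ ZFSet.prod S₁ S₂ := fun _ h => hA (ZFSet.mem_sep.1 h).1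
  have key : ∀ {a}, a ∈ V X → a ∈ star S₁ →
      (ZFSet.pair a b ∈ star A' ↔ ZFSet.pair a b ∈ star A ∧ a ∈ star (S₁ \ B)) := fun ha haS =>
    hm.pair_mem_star_restrict_iff h₁.1 h₂.1 (hP.mem_V_of_subset hA) (hP.mem_V_of_subset hA'P)
      hDV (fun s _ t _ => by
        rw [hA', ZFSet.mem_sep]
        refine and_congr_right fun _ => ⟨?_, fun hs => ⟨s, hs, t, rfl⟩⟩
        rintro ⟨s', hs', t', e⟩
        rwa [(ZFSet.pair_inj.1 e).1]) ha haS hb hbS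
  obtain ⟨s, hs, hsA'⟩ := h A' hA'P ((key ha haS).2 ⟨hab, (hD ha haS).2 haB⟩)
  have hsV := h₁.mem_V hs
  have hsS := hm.star_mem_star (h₁.mem_V hs) h₁.1 hs
  obtain ⟨hsA, hsD⟩ := (key (hm.mapsTo s hsV) hsS).1 hsA'
  refine (hD (hm.mapsTo s hsV) hsS).1 hsD ?_
  exact hm.star_mem_star hsV hBV (ZFSet.mem_sep.2 ⟨hs, hsA⟩)

theorem isTensorPair_of_hasStarWitness (hm : IsSingleModel X star) (h₁ : IsSetIn X S₁)
    (h₂ : IsSetIn X S₂) (ha : a ∈ V X) (haS : a ∈ star S₁) (hb : b ∈ V X) (hbS : b ∈ star S₂)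
    (h : HasStarWitness star S₁ S₂ a b) : IsTensorPair star S₁ S₂ a b := by
  rw [hm.isTensorPair_iff h₁ h₂ hb hbS]
  intro A hA
  refine ⟨hm.mem_star_sep_of_hasStarWitness h₁ h₂ ha haS hb hbS h hA, fun haB => ?_⟩
  by_contra hab
  -- The forward implication applied to the complement of `A`, whose set of good `s` is the
  -- complement of that for `A`.
  have := hm.mem_star_sep_of_hasStarWitness h₁ h₂ ha haS hb hbS h
    (fun _ h => (ZFSet.mem_sdiff.1 h).1)
    ((hm.pair_mem_star_diff_iff h₁ h₂ ha haS hb hbS hA).2 hab)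
  refine (hm.mem_star_compl_iff h₁.1 (h₁.mem_V_of_subset ZFSet.sep_subset)
    (h₁.mem_V_of_subset ZFSet.sep_subset) (fun s hs => ?_) ha haS).1 this haB
  rw [ZFSet.mem_sep, ZFSet.mem_sep, and_iff_right hs, and_iff_right hs]
  exact hm.pair_mem_star_diff_iff h₁ h₂ (hm.mapsTo s (h₁.mem_V hs))
      (hm.star_mem_star (h₁.mem_V hs) h₁.1 hs)
    hb hbS hA

theorem isTensorPair_iff_hasStarWitness (hm : IsSingleModel X star) (h₁ : IsSetIn X S₁)
    (h₂ : IsSetIn X S₂) (ha : a ∈ V X) (haS : a ∈ star S₁) (hb : b ∈ V X)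
    (hbS : b ∈ star S₂) : IsTensorPair star S₁ S₂ a b ↔ HasStarWitness star S₁ S₂ a b :=
  ⟨hm.hasStarWitness_of_isTensorPair h₁ h₂ ha hb hbS,
    hm.isTensorPair_of_hasStarWitness h₁ h₂ ha haS hb hbS⟩

theorem hasStarWitness_iff_dual (hm : IsSingleModel X star) (h₁ : IsSetIn X S₁)
    (h₂ : IsSetIn X S₂) (ha : a ∈ V X) (haS : a ∈ star S₁) (hb : b ∈ V X)
    (hbS : b ∈ star S₂) :
    HasStarWitness star S₁ S₂ a b ↔ ∀ A, A ⊆ ZFSet.prod S₁ S₂ →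
      (∀ s ∈ S₁, ZFSet.pair (star s) b ∈ star A) → ZFSet.pair a b ∈ star A := by
  have hsub : ∀ A, ZFSet.prod S₁ S₂ \ A ⊆ ZFSet.prod S₁ S₂ := fun A _ h =>
    (ZFSet.mem_sdiff.1 h).1
  have hs : ∀ {A}, A ⊆ ZFSet.prod S₁ S₂ → ∀ s ∈ S₁,
      (ZFSet.pair (star s) b ∈ star (ZFSet.prod S₁ S₂ \ A) ↔
        ZFSet.pair (star s) b ∉ star A) := fun hA s hs =>
    hm.pair_mem_star_diff_iff h₁ h₂ (hm.mapsTo s (h₁.mem_V hs))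
      (hm.star_mem_star (h₁.mem_V hs) h₁.1 hs) hb hbS
      hA
  constructor
  · intro h A hA hall
    by_contra hab
    obtain ⟨s, hsS, hsA⟩ := h _ (hsub A)
      ((hm.pair_mem_star_diff_iff h₁ h₂ ha haS hb hbS hA).2 hab)
    exact (hs hA s hsS).1 hsA (hall s hsS)
  · intro h A hA hab
    by_contra! hne
    exact (hm.pair_mem_star_diff_iff h₁ h₂ ha haS hb hbS hA).1
      (h _ (hsub A) fun s hsS => (hs hA s hsS).2 (hne s hsS)) hab

/-- With `∗s = s`, the set of good `s` is the section of `∗A` at `b`, cut down to `S₁`. Transfer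
with parameters `b` and `∗A` yields `∗b` and `∗∗A`. -/
theorem generated_iterate_two_eq_tensor (hm : IsSingleModel X star) (h₁ : IsSetIn X S₁)
    (h₂ : IsSetIn X S₂) (ha : a ∈ V X) (haS : a ∈ star S₁) (hb : b ∈ V X) (hbS : b ∈ star S₂)
    (hc : ∀ s ∈ S₁, star s = s) :
    generated (star^[2]) (ZFSet.prod S₁ S₂) (ZFSet.pair a (star b)) =
      tensor S₁ S₂ (generated star S₁ a) (generated star S₂ b) := by
  ext A
  rw [hm.mem_tensor_generated_iff h₁ h₂ hb hbS]
  refine and_congr_right fun hA => ?_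
  have hAV : A ∈ V X := (hm.base.isSetIn_prod h₁ h₂).mem_V_of_subset hA
  exact (hm.mem_star_section_iff' h₁.1 (h₁.mem_V_of_subset ZFSet.sep_subset) hb
    (hm.mapsTo A hAV) (fun s hs => by rw [ZFSet.mem_sep, and_iff_right hs, hc s hs]) ha haS).symm

/-! ## Images of tensor pairs -/

theorem app_star_star (hm : IsSingleModel X star) (h₁ : IsSetIn X S₁) (h₃ : IsSetIn X S₃)
    (hf : ZFSet.IsFunc S₁ S₃ f) {s : ZFSet.{u}} (hs : s ∈ S₁) :
    app (star f) (star s) = star (app f s) := by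
  have hsV := hm.mapsTo s (h₁.mem_V hs)
  have hsS := hm.star_mem_star (h₁.mem_V hs) h₁.1 hs
  have hfs := app_mem hf hs
  obtain ⟨h, h', h''⟩ := hm.app_star_spec h₁ h₃ hf hsV hsS
  exact hm.eq_of_pair_mem_star h₁ h₃ hf hsV h (hm.mapsTo _ (h₃.mem_V hfs)) hsS h'
    (hm.star_mem_star (h₃.mem_V hfs) h₃.1 hfs) h''
    ((hm.pair_mem_star_iff (h₁.mem_V hs) (h₃.mem_V hfs)
      ((hm.base.isSetIn_prod h₁ h₃).mem_V_of_subset hf.1)).2 (pair_app_mem hf hs))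

theorem pair_mem_star_iff_app (hm : IsSingleModel X star) (h₁ : IsSetIn X S₁)
    (h₂ : IsSetIn X S₂) (h₃ : IsSetIn X S₃) (h₄ : IsSetIn X S₄) (hf : ZFSet.IsFunc S₁ S₃ f)
    (hg : ZFSet.IsFunc S₂ S₄ g) {A B : ZFSet.{u}} (hA : A ⊆ ZFSet.prod S₁ S₂)
    (hB : B ⊆ ZFSet.prod S₃ S₄)
    (h : ∀ s ∈ S₁, ∀ t ∈ S₂, (ZFSet.pair s t ∈ A ↔ ZFSet.pair (app f s) (app g t) ∈ B))
    (ha : a ∈ V X) (haS : a ∈ star S₁) (hb : b ∈ V X) (hbS : b ∈ star S₂) :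
    ZFSet.pair a b ∈ star A ↔ ZFSet.pair (app (star f) a) (app (star g) b) ∈ star B := by
  have hX := hm.base
  obtain ⟨f₁, f₂, f₃⟩ := hm.app_star_spec h₁ h₃ hf ha haS
  obtain ⟨g₁, g₂, g₃⟩ := hm.app_star_spec h₂ h₄ hg hb hbS
  refine hm.pair_mem_star_preimage_iff h₁.1 h₂.1 h₃.1 h₄.1
    ((hX.isSetIn_prod h₁ h₃).mem_V_of_subset hf.1) ((hX.isSetIn_prod h₂ h₄).mem_V_of_subset hg.1)
    ((hX.isSetIn_prod h₁ h₂).mem_V_of_subset hA) ((hX.isSetIn_prod h₃ h₄).mem_V_of_subset hB)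
    (fun s hs t ht s' _ t' _ hss' htt' => ?_) ha haS hb hbS f₁ f₂ g₁ g₂ f₃ g₃
  rw [h s hs t ht, app_eq_of_pair_mem hf hss', app_eq_of_pair_mem hg htt']

theorem hasStarWitness_image (hm : IsSingleModel X star) (h₁ : IsSetIn X S₁)
    (h₂ : IsSetIn X S₂) (h₃ : IsSetIn X S₃) (h₄ : IsSetIn X S₄) (hf : ZFSet.IsFunc S₁ S₃ f)
    (hg : ZFSet.IsFunc S₂ S₄ g) (ha : a ∈ V X) (haS : a ∈ star S₁) (hb : b ∈ V X)
    (hbS : b ∈ star S₂) (h : HasStarWitness star S₁ S₂ a b) :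
    HasStarWitness star S₃ S₄ (app (star f) a) (app (star g) b) := by
  intro B hB hab
  set A := ZFSet.sep (fun p => ∃ s t, p = ZFSet.pair s t ∧
    ZFSet.pair (app f s) (app g t) ∈ B) (ZFSet.prod S₁ S₂) with hA
  have hAB : ∀ s ∈ S₁, ∀ t ∈ S₂,
      (ZFSet.pair s t ∈ A ↔ ZFSet.pair (app f s) (app g t) ∈ B) := fun s hs t ht => by
    rw [hA, ZFSet.mem_sep, ZFSet.pair_mem_prod, and_iff_right ⟨hs, ht⟩]
    refine ⟨?_, fun h => ⟨s, t, rfl, h⟩⟩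
    rintro ⟨s', t', e, h⟩
    obtain ⟨rfl, rfl⟩ := ZFSet.pair_inj.1 e
    exact h
  obtain ⟨s, hs, hsA⟩ := h A ZFSet.sep_subset ((hm.pair_mem_star_iff_app h₁ h₂ h₃ h₄ hf hg
    ZFSet.sep_subset hB hAB ha haS hb hbS).2 hab)
  refine ⟨app f s, app_mem hf hs, ?_⟩
  rw [← hm.app_star_star h₁ h₃ hf hs]
  exact (hm.pair_mem_star_iff_app h₁ h₂ h₃ h₄ hf hg ZFSet.sep_subset hB hAB
    (hm.mapsTo s (h₁.mem_V hs)) (hm.star_mem_star (h₁.mem_V hs) h₁.1 hs) hb hbS).1 hsA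

/-- Injectivity of both maps makes `A` the preimage of its image `B`; surjectivity of `f` pulls a
witness in `S₃` back to `S₁`. -/
theorem hasStarWitness_of_image (hm : IsSingleModel X star) (h₁ : IsSetIn X S₁)
    (h₂ : IsSetIn X S₂) (h₃ : IsSetIn X S₃) (h₄ : IsSetIn X S₄) (hf : IsBijFunc S₁ S₃ f)
    (hg : IsInjFunc S₂ S₄ g) (ha : a ∈ V X) (haS : a ∈ star S₁) (hb : b ∈ V X)
    (hbS : b ∈ star S₂)
    (h : HasStarWitness star S₃ S₄ (app (star f) a) (app (star g) b)) :
    HasStarWitness star S₁ S₂ a b := by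
  intro A hA hab
  set B := ZFSet.sep (fun p => ∃ s t, ZFSet.pair s t ∈ A ∧
    p = ZFSet.pair (app f s) (app g t)) (ZFSet.prod S₃ S₄) with hB
  have hAB : ∀ s ∈ S₁, ∀ t ∈ S₂,
      (ZFSet.pair s t ∈ A ↔ ZFSet.pair (app f s) (app g t) ∈ B) := fun s hs t ht => by
    rw [hB, ZFSet.mem_sep, ZFSet.pair_mem_prod,
      and_iff_right ⟨app_mem hf.1.1 hs, app_mem hg.1 ht⟩]
    refine ⟨fun h => ⟨s, t, h, rfl⟩, ?_⟩
    rintro ⟨s', t', h, e⟩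
    obtain ⟨hs', ht'⟩ := ZFSet.pair_mem_prod.1 (hA h)
    obtain ⟨es, et⟩ := ZFSet.pair_inj.1 e
    rwa [hf.1.2 s hs s' hs' es, hg.2 t ht t' ht' et]
  obtain ⟨r, hr, hrB⟩ := h B ZFSet.sep_subset ((hm.pair_mem_star_iff_app h₁ h₂ h₃ h₄ hf.1.1 hg.1
    hA ZFSet.sep_subset hAB ha haS hb hbS).1 hab)
  obtain ⟨s, hs, rfl⟩ := hf.2 r hr
  refine ⟨s, hs, ?_⟩
  rw [← hm.app_star_star h₁ h₃ hf.1.1 hs] at hrB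
  exact (hm.pair_mem_star_iff_app h₁ h₂ h₃ h₄ hf.1.1 hg.1 hA ZFSet.sep_subset hAB
    (hm.mapsTo s (h₁.mem_V hs)) (hm.star_mem_star (h₁.mem_V hs) h₁.1 hs) hb hbS).2 hrB

theorem star_eq_self_of_completelyCoherent (hm : IsSingleModel X star) (h₁ : IsSetIn X S₁)
    (hc : CompletelyCoherent star S₁) {s : ZFSet.{u}} (hs : s ∈ S₁) : star s = s :=
  hm.eq_star_of_mem_star_singleton (h₁.mem_V hs)
    -- Coherence is needed only for singletons: it gives `s ∈ ∗{s}`.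
    (hc {s, s} (fun t ht => by
      rcases ZFSet.mem_pair.1 ht with rfl | rfl <;> exact hs) (by simp))

end IsSingleModel

end Hyperext

theorem mainTheorem2 (X : ZFSet.{u}) (star : ZFSet.{u} → ZFSet.{u})
    (hmodel : Hyperext.IsSingleModel X star)
    (S₁ S₂ : ZFSet.{u}) (hS₁ : Hyperext.IsSetIn X S₁) (hS₂ : Hyperext.IsSetIn X S₂)
    (α₁ α₂ : ZFSet.{u}) (hα₁ : α₁ ∈ Hyperext.V X) (hα₂ : α₂ ∈ Hyperext.V X)
    (hα : ZFSet.pair α₁ α₂ ∈ star (ZFSet.prod S₁ S₂)) :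
    (Hyperext.CompletelyCoherent star S₁ →
      List.TFAE
        [ -- tensor pair
          Hyperext.IsTensorPair star S₁ S₂ α₁ α₂,
          -- equality of the generated ultrafilters
          Hyperext.generated star (ZFSet.prod S₁ S₂) (ZFSet.pair α₁ α₂) =
            Hyperext.generated (star^[2]) (ZFSet.prod S₁ S₂) (ZFSet.pair α₁ (star α₂)),
          -- witness in S₁
          ∀ A, A ⊆ ZFSet.prod S₁ S₂ → ZFSet.pair α₁ α₂ ∈ star A →
            ∃ s ∈ S₁, ZFSet.pair s α₂ ∈ star A,
          -- dual of the previous condition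
          ∀ A, A ⊆ ZFSet.prod S₁ S₂ → (∀ s ∈ S₁, ZFSet.pair s α₂ ∈ star A) →
            ZFSet.pair α₁ α₂ ∈ star A,
          -- all images
          ∀ S₃ S₄, Hyperext.IsSetIn X S₃ → Hyperext.IsSetIn X S₄ →
            ∀ f g, ZFSet.IsFunc S₁ S₃ f → ZFSet.IsFunc S₂ S₄ g →
              Hyperext.IsTensorPair star S₃ S₄
                (Hyperext.app (star f) α₁) (Hyperext.app (star g) α₂),
          -- some injective image
          ∃ S₃ S₄, Hyperext.IsSetIn X S₃ ∧ Hyperext.IsSetIn X S₄ ∧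
            ∃ f g, Hyperext.IsBijFunc S₁ S₃ f ∧ Hyperext.IsInjFunc S₂ S₄ g ∧
              Hyperext.IsTensorPair star S₃ S₄
                (Hyperext.app (star f) α₁) (Hyperext.app (star g) α₂) ]) ∧
    -- without coherence: the elements `s` of `S₁` are identified with `∗s`
    List.TFAE
      [ -- tensor pair
        Hyperext.IsTensorPair star S₁ S₂ α₁ α₂,
        -- witness in S₁
        ∀ A, A ⊆ ZFSet.prod S₁ S₂ → ZFSet.pair α₁ α₂ ∈ star A →
          ∃ s ∈ S₁, ZFSet.pair (star s) α₂ ∈ star A,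
        -- dual of the previous condition
        ∀ A, A ⊆ ZFSet.prod S₁ S₂ → (∀ s ∈ S₁, ZFSet.pair (star s) α₂ ∈ star A) →
          ZFSet.pair α₁ α₂ ∈ star A,
        -- all images
        ∀ S₃ S₄, Hyperext.IsSetIn X S₃ → Hyperext.IsSetIn X S₄ →
          ∀ f g, ZFSet.IsFunc S₁ S₃ f → ZFSet.IsFunc S₂ S₄ g →
            Hyperext.IsTensorPair star S₃ S₄
              (Hyperext.app (star f) α₁) (Hyperext.app (star g) α₂),
        -- some injective image
        ∃ S₃ S₄, Hyperext.IsSetIn X S₃ ∧ Hyperext.IsSetIn X S₄ ∧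
          ∃ f g, Hyperext.IsBijFunc S₁ S₃ f ∧ Hyperext.IsInjFunc S₂ S₄ g ∧
            Hyperext.IsTensorPair star S₃ S₄
              (Hyperext.app (star f) α₁) (Hyperext.app (star g) α₂) ] := by
  obtain ⟨ha, hb⟩ := (hmodel.pair_mem_star_prod_iff hS₁ hS₂ hα₁ hα₂).1 hα
  have h₁₃ := hmodel.isTensorPair_iff_hasStarWitness hS₁ hS₂ hα₁ ha hα₂ hb
  have h₃₄ := hmodel.hasStarWitness_iff_dual hS₁ hS₂ hα₁ ha hα₂ hb
  have himage : ∀ {S₃ S₄ f g}, Hyperext.IsSetIn X S₃ → Hyperext.IsSetIn X S₄ →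
      ZFSet.IsFunc S₁ S₃ f → ZFSet.IsFunc S₂ S₄ g →
      (Hyperext.IsTensorPair star S₃ S₄ (Hyperext.app (star f) α₁) (Hyperext.app (star g) α₂) ↔
        Hyperext.HasStarWitness star S₃ S₄
          (Hyperext.app (star f) α₁) (Hyperext.app (star g) α₂)) := by
    intro S₃ S₄ f g h₃ h₄ hf hg
    obtain ⟨f₁, f₂, -⟩ := hmodel.app_star_spec hS₁ h₃ hf hα₁ ha
    obtain ⟨g₁, g₂, -⟩ := hmodel.app_star_spec hS₂ h₄ hg hα₂ hb
    exact hmodel.isTensorPair_iff_hasStarWitness h₃ h₄ f₁ f₂ g₁ g₂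
  have hB : List.TFAE
      [ Hyperext.IsTensorPair star S₁ S₂ α₁ α₂,
        ∀ A, A ⊆ ZFSet.prod S₁ S₂ → ZFSet.pair α₁ α₂ ∈ star A →
          ∃ s ∈ S₁, ZFSet.pair (star s) α₂ ∈ star A,
        ∀ A, A ⊆ ZFSet.prod S₁ S₂ → (∀ s ∈ S₁, ZFSet.pair (star s) α₂ ∈ star A) →
          ZFSet.pair α₁ α₂ ∈ star A,
        ∀ S₃ S₄, Hyperext.IsSetIn X S₃ → Hyperext.IsSetIn X S₄ →
          ∀ f g, ZFSet.IsFunc S₁ S₃ f → ZFSet.IsFunc S₂ S₄ g →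
            Hyperext.IsTensorPair star S₃ S₄
              (Hyperext.app (star f) α₁) (Hyperext.app (star g) α₂),
        ∃ S₃ S₄, Hyperext.IsSetIn X S₃ ∧ Hyperext.IsSetIn X S₄ ∧
          ∃ f g, Hyperext.IsBijFunc S₁ S₃ f ∧ Hyperext.IsInjFunc S₂ S₄ g ∧
            Hyperext.IsTensorPair star S₃ S₄
              (Hyperext.app (star f) α₁) (Hyperext.app (star g) α₂) ] := by
    tfae_have 1 ↔ 2 := h₁₃
    tfae_have 2 ↔ 3 := h₃₄
    tfae_have 2 → 4 := fun h S₃ S₄ h₃ h₄ f g hf hg => (himage h₃ h₄ hf hg).2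
      (hmodel.hasStarWitness_image hS₁ hS₂ h₃ h₄ hf hg hα₁ ha hα₂ hb h)
    tfae_have 4 → 5 := fun h => ⟨S₁, S₂, hS₁, hS₂, Hyperext.idFunc S₁, Hyperext.idFunc S₂,
      Hyperext.isBijFunc_idFunc S₁, (Hyperext.isBijFunc_idFunc S₂).1,
      h S₁ S₂ hS₁ hS₂ _ _ (Hyperext.isFunc_idFunc S₁) (Hyperext.isFunc_idFunc S₂)⟩
    -- The given image need not be the identity one, so the witness property itself is pulled back
    -- along `f` and `g`.
    tfae_have 5 → 2 := by
      rintro ⟨S₃, S₄, h₃, h₄, f, g, hf, hg, h⟩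
      exact hmodel.hasStarWitness_of_image hS₁ hS₂ h₃ h₄ hf hg hα₁ ha hα₂ hb
        ((himage h₃ h₄ hf.1.1 hg.1).1 h)
    tfae_finish
  refine ⟨fun hc => ?_, hB⟩
  have hstar : ∀ s ∈ S₁, star s = s := fun s hs =>
    hmodel.star_eq_self_of_completelyCoherent hS₁ hc hs
  tfae_have 1 ↔ 2 := by
    rw [hmodel.generated_iterate_two_eq_tensor hS₁ hS₂ hα₁ ha hα₂ hb hstar]
    rfl
  tfae_have 1 ↔ 3 := (hB.out 0 1).trans <| forall₃_congr fun A _ _ =>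
    exists_congr fun s => and_congr_right fun hs => by rw [hstar s hs]
  tfae_have 1 ↔ 4 := (hB.out 0 2).trans <| forall₂_congr fun A _ =>
    imp_congr_left <| forall₂_congr fun s hs => by rw [hstar s hs]
  tfae_have 1 ↔ 5 := hB.out 0 3
  tfae_have 1 ↔ 6 := hB.out 0 4
  tfae_finish
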